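/- Let $\mathcal M$ be a non-empty compact, locally connected Hausdorff space, let $\vec\varphi,\vec\chi:\mathcal M\to\mathbb R^k$ be continuous, and suppose that $\max_{P\in\mathcal M}\|\vec\varphi(P)-\vec\chi(P)\|_\infty\le\epsilon$. Let $(\vec l,\vec b)$ be an admissible pair, that is, $\vec l,\vec b\in\mathbb R^k$, $\sum_i l_i^2=1$, $l_i>0$ for all $i$, and $\sum_i b_i=0$. Put $F^{\vec\varphi}_{(\vec l,\vec b)}(P)=\max_{1\le i\le k}\frac{\varphi_i(P)-b_i}{l_i}$, and define $F^{\vec\chi}_{(\vec l,\vec b)}$ in the same way. Then $$d_{match}\bigl(\ell_{(\mathcal M,F^{\vec\varphi}_{(\vec l,\vec b)})},\ell_{(\mathcal M,F^{\vec\chi}_{(\vec l,\vec b)})}\bigr)\le\frac{\epsilon}{\min_{1\le i\le k}l_i}.$$ Here, for a continuous $f:\mathcal M\to\mathbb R$ and real $x<y$, the size function $\ell_{(\mathcal M,f)}(x,y)$ is the number of equivalence classes of $\{P: f(P)\le x\}$ under the relation that identifies two points lying in a common connected subset of $\{P: f(P)\le y\}$. The matching distance $d_{match}$ of two such size functions is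 defined as follows. For a size function $\ell$, the multiplicity of a point $(x,y)$ with $x<y$ is $$\min_{\eta>0,\ x+\eta<y-\eta}\ \ell(x+\eta,y-\eta)-\ell(x-\eta,y-\eta)-\ell(x+\eta,y+\eta)+\ell(x-\eta,y+\eta),$$ and that of a point at infinity $(x,\infty)$, $x\in\mathbb R$, is $$\min_{\eta>0,\ x+\eta<1/\eta}\ \ell(x+\eta,1/\eta)-\ell(x-\eta,1/\eta).$$ Points of positive multiplicity are called cornerpoints. A representative sequence of $\ell$ is a sequence $(a_i)_{i\in\mathbb N}$ in which each cornerpoint occurs exactly as often as its multiplicity says, while all the other terms, infinitely many, lie on the diagonal $\{(x,x):x\in\mathbb R\}$. The cost of moving one point to another is $$d\bigl((x,y),(x',y')\bigr)=\min\Bigl\{\max\{|x-x'|,|y-y'|\},\ \max\bigl\{\tfrac{y-x}2,\tfrac{y'-x'}2\bigr\}\Bigr\}$$ for finite points, $d((x,\infty),(x',\infty))=|x-x'|$, and $+\infty$ between a finite point and a point at infinity. If $(a_i)$ and $(b_i)$ are representative sequences of $\ell_1$ and $\ell_2$, then $$d_{match}(\ell_1,\ell_2)=\inf_\sigma\sup_{i\in\mathbb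 N} d(a_i,b_{\sigma(i)})\in[0,+\infty],$$ where $\sigma$ runs through all bijections $\mathbb N\to\mathbb N$; the value does not depend on the chosen representative sequences. -/

import Mathlib

open scoped ENNReal

namespace SizeTheory

/-- The lower level set `M⟨φ ≼ x⟩ = {P | φ P ≤ x}`. For `α = Fin k → ℝ` the order is the
coordinatewise one, `∀ i, φ P i ≤ x i`; for `α = ℝ` it is the usual order. -/
def lowerSet {M α : Type*} [Preorder α] (φ : M → α) (x : α) : Set M :=
  {P | φ P ≤ x}

/-- `P` and `Q` are `⟨φ ≼ y⟩`-connected: some connected subset of `M⟨φ ≼ y⟩` contains both. -/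
def ConnectedBelow {M α : Type*} [TopologicalSpace M] [Preorder α] (φ : M → α) (y : α)
    (P Q : M) : Prop :=
  ∃ C : Set M, IsConnected C ∧ C ⊆ lowerSet φ y ∧ P ∈ C ∧ Q ∈ C

/-- For `x ≤ y`, `⟨φ ≼ y⟩`-connectedness is an equivalence relation on `M⟨φ ≼ x⟩`. -/
theorem connectedBelow_equivalence {M α : Type*} [TopologicalSpace M] [Preorder α] (φ : M → α)
    {x y : α} (hxy : x ≤ y) :
    Equivalence (fun P Q : lowerSet φ x => ConnectedBelow φ y (P : M) (Q : M)) where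
  refl P := ⟨{(P : M)}, isConnected_singleton,
    Set.singleton_subset_iff.2 (le_trans (show φ P ≤ x from P.2) hxy), rfl, rfl⟩
  symm := fun ⟨C, hC, hs, hP, hQ⟩ => ⟨C, hC, hs, hQ, hP⟩
  trans := fun ⟨C, hC, hs, hP, hQ⟩ ⟨D, hD, ht, hQ', hR⟩ =>
    ⟨C ∪ D, hC.union ⟨_, hQ, hQ'⟩ hD, Set.union_subset hs ht, Or.inl hP, Or.inr hR⟩

/-- The size function of `(M, φ)`: the number of classes into which `M⟨φ ≼ x⟩` is divided by
`⟨φ ≼ y⟩`-connectedness. It is used only for `x < y`, where that relation is an equivalence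
relation. -/
noncomputable def sizeFunction {M α : Type*} [TopologicalSpace M] [Preorder α] (φ : M → α)
    (x y : α) : ℕ :=
  Nat.card (Quot (fun P Q : lowerSet φ x => ConnectedBelow φ y (P : M) (Q : M)))

/-- On a compact locally connected space and for a continuous real function the number of classes
is finite, so that `sizeFunction` really counts them. -/
theorem finite_classes {M : Type*} [TopologicalSpace M] [CompactSpace M] [LocallyConnectedSpace M]
    {f : M → ℝ} (hf : Continuous f) {x y : ℝ} (hxy : x < y) :
    Finite (Quot (fun P Q : lowerSet f x => ConnectedBelow f y (P : M) (Q : M))) := by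
  have hopen : IsOpen {P | f P < y} := isOpen_lt hf continuous_const
  have hK : IsCompact (lowerSet f x) := (isClosed_le hf continuous_const).isCompact
  have hx : ∀ P ∈ lowerSet f x, P ∈ {P | f P < y} := fun P hP => lt_of_le_of_lt hP hxy
  obtain ⟨t, ht, hcov⟩ := hK.elim_nhds_subcover (fun P => connectedComponentIn {P | f P < y} P)
    (fun P hP => hopen.connectedComponentIn.mem_nhds (mem_connectedComponentIn (hx P hP)))
  refine Finite.of_surjective
    (fun P : t => Quot.mk _ (⟨P.1, ht P.1 P.2⟩ : lowerSet f x)) ?_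
  rintro ⟨Q⟩
  obtain ⟨P, hP, hQ⟩ := Set.mem_iUnion₂.1 (hcov Q.2)
  refine ⟨⟨P, hP⟩, Quot.sound ⟨connectedComponentIn {P | f P < y} P,
    isConnected_connectedComponentIn_iff.2 (hx P (ht P hP)),
    (connectedComponentIn_subset _ _).trans (fun R (hR : f R < y) => (le_of_lt hR : f R ≤ y)),
    mem_connectedComponentIn (hx P (ht P hP)), hQ⟩⟩

/-- Points of the extended plane: a finite point `(x, y)`, or a point at infinity `(x, ∞)`, which
stands for the vertical line with abscissa `x`. -/
inductive ExtPoint : Type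
  | finite (x y : ℝ) : ExtPoint
  | infinite (x : ℝ) : ExtPoint

/-- The point lies on the diagonal `Δ`. -/
def ExtPoint.OnDiagonal (p : ExtPoint) : Prop := ∃ x : ℝ, p = ExtPoint.finite x x

/-- The multiplicity of a point for a size function `l` of two real variables:
* for `(x, y)` with `x < y`, the minimum, over `ε > 0` with `x + ε < y - ε`, of
  `l (x+ε) (y-ε) - l (x-ε) (y-ε) - l (x+ε) (y+ε) + l (x-ε) (y+ε)`
  (and `0` when `x ≥ y`, since no such `ε` exists);
* for `(x, ∞)`, the minimum, over `ε > 0` with `x + ε < 1/ε`, of `l (x+ε) (1/ε) - l (x-ε) (1/ε)`.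

For a size function these integers are nonnegative. -/
noncomputable def cornerMultiplicity (l : ℝ → ℝ → ℕ) : ExtPoint → ℕ
  | ExtPoint.finite x y => sInf {n : ℕ | ∃ ε : ℝ, 0 < ε ∧ x + ε < y - ε ∧
      (n : ℤ) = (l (x + ε) (y - ε) : ℤ) - l (x - ε) (y - ε) - l (x + ε) (y + ε)
        + l (x - ε) (y + ε)}
  | ExtPoint.infinite x => sInf {n : ℕ | ∃ ε : ℝ, 0 < ε ∧ x + ε < 1 / ε ∧
      (n : ℤ) = (l (x + ε) (1 / ε) : ℤ) - l (x - ε) (1 / ε)}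

/-- A cornerpoint (proper, or at infinity) is a point of positive multiplicity. -/
def IsCornerpoint (l : ℝ → ℝ → ℕ) (p : ExtPoint) : Prop := 0 < cornerMultiplicity l p

/-- A representative sequence of a size function lists every cornerpoint (proper or at infinity) as
often as its multiplicity says; all its other terms, infinitely many, lie on the diagonal. -/
structure IsRepresentativeSequence (l : ℝ → ℝ → ℕ) (a : ℕ → ExtPoint) : Prop where
  cornerpoint_or_diagonal : ∀ i, IsCornerpoint l (a i) ∨ (a i).OnDiagonal
  encard_eq : ∀ p, IsCornerpoint l p → {i | a i = p}.encard = (cornerMultiplicity l p : ℕ∞)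
  infinite_diagonal : {i | (a i).OnDiagonal}.Infinite

/-- The cost of moving a point to another one: the minimum of the max-norm distance of the two
points and of the cost of moving both of them onto the diagonal, with the usual conventions
for `∞` (a point at infinity has infinite distance from the finite ones). -/
noncomputable def pointCost : ExtPoint → ExtPoint → ℝ≥0∞
  | ExtPoint.finite x y, ExtPoint.finite x' y' =>
      ENNReal.ofReal (min (max |x - x'| |y - y'|) (max ((y - x) / 2) ((y' - x') / 2)))
  | ExtPoint.infinite x, ExtPoint.infinite x' => ENNReal.ofReal |x - x'|
  | ExtPoint.finite _ _, ExtPoint.infinite _ => ⊤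
  | ExtPoint.infinite _, ExtPoint.finite _ _ => ⊤

/-- The matching distance `inf_σ sup_i d(a_i, b_{σ(i)})` of two size functions, where `a` and `b` are
representative sequences and `σ` runs through the bijections of `ℕ`. The value does not depend on
the representative sequences: two of them differ by a rearrangement and by the choice of the
diagonal points, and the cost does not depend on which diagonal point is used. -/
noncomputable def matchingDistance (l₁ l₂ : ℝ → ℝ → ℕ) : ℝ≥0∞ :=
  ⨅ (a : ℕ → ExtPoint) (_ : IsRepresentativeSequence l₁ a)
    (b : ℕ → ExtPoint) (_ : IsRepresentativeSequence l₂ b)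
    (σ : Equiv.Perm ℕ), ⨆ i : ℕ, pointCost (a i) (b (σ i))

/-- Admissible pairs: `l` is a unit vector for the Euclidean norm with positive coordinates, and the
coordinates of `b` add up to zero. There are none for `k = 0`. -/
structure Admissible {k : ℕ} (l b : Fin k → ℝ) : Prop where
  unit : ‖WithLp.toLp 2 l‖ = 1
  pos : ∀ i, 0 < l i
  sum_eq_zero : ∑ i, b i = 0

/-- `F_{(l,b)}^φ (P) = max_i (φ_i(P) - b_i) / l_i`. -/
noncomputable def reduced {M : Type*} {k : ℕ} (l b : Fin k → ℝ) (φ : M → Fin k → ℝ) (P : M) : ℝ :=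
  ⨆ i : Fin k, (φ P i - b i) / l i

end SizeTheory

namespace SizeTheory

/-! ### Counting components -/

/-! Stability holds for any two continuous functions with |f - g| ≤ δ; the reduced functions satisfy
this with δ = ε / min l_i. The diagrams of f and g are compared through a hybrid, `mixedCount f g`,
which counts the components of {g ≤ y} meeting {f ≤ x} and behaves like a size function for x + δ <
y. It takes births from f and deaths from g: between f and the hybrid only deaths move, between the
hybrid and g only births, each by at most δ. The diagram of the hybrid thus indexes a partial
matching whose pairs are δ-close in the max norm. The points it misses have persistence at most 2δ,
so sending them to the diagonal costs at most δ.

Each half is a one-dimensional problem. For a fixed birth b, the number of newborns still distinct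
at y is antitone in y, and the multiplicity of (b, d) counts its drops at d
(`IsRank.nonempty_fin_multiplicity_equiv`). Interleaved functions have drops of equal index at
distance at most δ (`IsDrop.transfer`), and a matching that preserves b and the index is injective.
The half where births move follows by reflection in the antidiagonal. All monotonicity rests on one
counting inequality, `componentCount_add_le`. Points at infinity are drops of `globalCount` and are
matched bijectively by index. -/

theorem ncard_image_add_ncard_image_le {α β γ : Type*} {κ : α → β} {κ' : α → γ} {A B : Set α}
    (hAB : A ⊆ B) (hκ : ∀ P ∈ B, ∀ Q ∈ B, κ P = κ Q → κ' P = κ' Q) (hfin : (κ '' B).Finite) :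
    (κ' '' B).ncard + (κ '' A).ncard ≤ (κ '' B).ncard + (κ' '' A).ncard := by
  classical
  obtain rfl | ⟨P₀, hP₀⟩ := B.eq_empty_or_nonempty
  · simp [Set.subset_empty_iff.1 hAB]
  have : Nonempty α := ⟨P₀⟩
  -- On B the map `κ'` factors through `κ` via `π`. A `κ'`-value attained on B but not on A comes
  -- from a `κ`-value of the same kind, so there are no more of the former than of the latter.
  set π : β → γ := fun c => κ' (Function.invFunOn κ B c)
  have hπ : ∀ P ∈ B, π (κ P) = κ' P := fun P hP =>
    hκ _ (Function.invFunOn_mem ⟨P, hP, rfl⟩) _ hP (Function.invFunOn_eq ⟨P, hP, rfl⟩)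
  have hfin' : (κ' '' B).Finite := (hfin.image π).subset <| by
    rintro _ ⟨P, hP, rfl⟩
    exact ⟨κ P, ⟨P, hP, rfl⟩, hπ P hP⟩
  have h1 := Set.ncard_sdiff_add_ncard_of_subset (Set.image_mono (f := κ) hAB) hfin
  have h2 := Set.ncard_sdiff_add_ncard_of_subset (Set.image_mono (f := κ') hAB) hfin'
  have h3 : (κ' '' B \ κ' '' A) ⊆ π '' (κ '' B \ κ '' A) := by
    rintro _ ⟨⟨P, hP, rfl⟩, hPA⟩
    refine ⟨κ P, ⟨⟨P, hP, rfl⟩, ?_⟩, hπ P hP⟩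
    rintro ⟨Q, hQ, hQP⟩
    exact hPA ⟨Q, hQ, hκ _ (hAB hQ) _ hP hQP⟩
  have h4 := Set.ncard_le_ncard h3 (hfin.sdiff.image π)
  have h5 := Set.ncard_image_le (f := π) (s := κ '' B \ κ '' A) hfin.sdiff
  omega

theorem lowerSet_mono {M : Type*} {f : M → ℝ} {x y : ℝ} (h : x ≤ y) : lowerSet f x ⊆ lowerSet f y :=
  fun P (hP : f P ≤ x) => (hP.trans h : f P ≤ y)

theorem lowerSet_subset_lowerSet {M : Type*} {f g : M → ℝ} {c x y : ℝ} (hfg : ∀ P, |f P - g P| ≤ c)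
    (h : x + c ≤ y) : lowerSet f x ⊆ lowerSet g y := fun P (hP : f P ≤ x) => by
  have := (abs_le.1 (hfg P)).1
  change g P ≤ y
  linarith

section

variable {M : Type*} [TopologicalSpace M]

/-- The number of connected components of `K` that meet `A`, for `A ⊆ K`. -/
noncomputable def componentCount (A K : Set M) : ℕ := (connectedComponentIn K '' A).ncard

/-- A component of K' that meets B but misses A contains a component of K with the same property, so
such components cannot become more numerous when K grows. -/
theorem componentCount_add_le {A B K K' : Set M} (hAB : A ⊆ B) (hBK : B ⊆ K) (hK : K ⊆ K')
    (hfin : (connectedComponentIn K '' B).Finite) :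
    componentCount B K' + componentCount A K ≤ componentCount B K + componentCount A K' := by
  refine ncard_image_add_ncard_image_le hAB (fun P hP Q hQ h => ?_) hfin
  refine connectedComponentIn_eq (connectedComponentIn_mono P hK ?_)
  rw [h]
  exact mem_connectedComponentIn (hBK hQ)

theorem connectedBelow_iff {g : M → ℝ} {y : ℝ} {P Q : M} (hP : P ∈ lowerSet g y)
    (hQ : Q ∈ lowerSet g y) :
    ConnectedBelow g y P Q ↔
      connectedComponentIn (lowerSet g y) P = connectedComponentIn (lowerSet g y) Q := by
  constructor
  · rintro ⟨C, hC, hs, hPC, hQC⟩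
    exact connectedComponentIn_eq (hC.isPreconnected.subset_connectedComponentIn hPC hs hQC)
  · intro h
    refine ⟨connectedComponentIn (lowerSet g y) P, isConnected_connectedComponentIn_iff.2 hP,
      connectedComponentIn_subset _ _, mem_connectedComponentIn hP, ?_⟩
    rw [h]
    exact mem_connectedComponentIn hQ

/-- The classes of `M⟨f ≤ x⟩` correspond to the components of `M⟨f ≤ y⟩` that meet it. -/
noncomputable def classesEquiv (f : M → ℝ) {x y : ℝ} (hxy : x ≤ y) :
    Quot (fun P Q : lowerSet f x => ConnectedBelow f y (P : M) (Q : M)) ≃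
      connectedComponentIn (lowerSet f y) '' lowerSet f x :=
  Equiv.ofBijective
    (Quot.lift (fun P => ⟨connectedComponentIn (lowerSet f y) P, P, P.2, rfl⟩) fun P Q h =>
      Subtype.ext ((connectedBelow_iff (lowerSet_mono hxy P.2) (lowerSet_mono hxy Q.2)).1 h)) <| by
    constructor
    · rintro ⟨P⟩ ⟨Q⟩ h
      exact Quot.sound ((connectedBelow_iff (lowerSet_mono hxy P.2) (lowerSet_mono hxy Q.2)).2
        (congrArg Subtype.val h))
    · rintro ⟨_, P, hP, rfl⟩
      exact ⟨Quot.mk _ ⟨P, hP⟩, rfl⟩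

theorem sizeFunction_eq_componentCount (f : M → ℝ) {x y : ℝ} (hxy : x ≤ y) :
    sizeFunction f x y = componentCount (lowerSet f x) (lowerSet f y) := by
  rw [sizeFunction, Nat.card_congr (classesEquiv f hxy), componentCount, Nat.card_coe_set_eq]

theorem finite_components [CompactSpace M] [LocallyConnectedSpace M] {f g : M → ℝ}
    (hg : Continuous g) {c x y : ℝ} (hfg : ∀ P, |f P - g P| ≤ c) (hxy : x + c < y) :
    (connectedComponentIn (lowerSet g y) '' lowerSet f x).Finite := by
  have := finite_classes hg hxy
  have h : (connectedComponentIn (lowerSet g y) '' lowerSet g (x + c)).Finite :=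
    by
    have := Finite.of_equiv _ (classesEquiv g hxy.le)
    exact Set.toFinite _
  exact h.subset (Set.image_mono (lowerSet_subset_lowerSet hfg le_rfl))

end

/-! ### Stationary values -/

/-- The least value of `h` at an `ε > 0` satisfying `V`. -/
noncomputable def germ (V : ℝ → Prop) (h : ℝ → ℤ) : ℕ :=
  sInf {n : ℕ | ∃ ε : ℝ, 0 < ε ∧ V ε ∧ (n : ℤ) = h ε}

/-- A least natural value is attained at some `ε₀`, and monotonicity freezes `h` from there down.
Minima over ε thus become eventual values, which can be added and compared. -/
theorem germ_spec {V : ℝ → Prop} {h : ℝ → ℤ} (hV : ∃ ε, 0 < ε ∧ V ε)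
    (hV' : ∀ ε ε', 0 < ε → ε ≤ ε' → V ε' → V ε) (hnn : ∀ ε, 0 < ε → V ε → 0 ≤ h ε)
    (hmono : ∀ ε ε', 0 < ε → ε ≤ ε' → V ε' → h ε ≤ h ε') :
    ∃ ε₀, 0 < ε₀ ∧ V ε₀ ∧ ∀ ε, 0 < ε → ε ≤ ε₀ → h ε = germ V h := by
  obtain ⟨ε₁, h₁, hV₁⟩ := hV
  have hne : {n : ℕ | ∃ ε : ℝ, 0 < ε ∧ V ε ∧ (n : ℤ) = h ε}.Nonempty :=
    ⟨(h ε₁).toNat, ε₁, h₁, hV₁, Int.toNat_of_nonneg (hnn _ h₁ hV₁)⟩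
  obtain ⟨ε₀, h₀, hV₀, he⟩ := Nat.sInf_mem hne
  refine ⟨ε₀, h₀, hV₀, fun ε hε hle => le_antisymm ?_ ?_⟩
  · exact (hmono _ _ hε hle hV₀).trans he.symm.le
  · have hVε := hV' _ _ hε hle hV₀
    have : germ V h ≤ (h ε).toNat :=
      Nat.sInf_le ⟨ε, hε, hVε, Int.toNat_of_nonneg (hnn _ hε hVε)⟩
    have := hnn _ hε hVε
    omega

/-! ### Drops of antitone functions -/

/-- The function `h` on `U` drops from a value `> i` to a value `≤ i` at `d`. -/
def IsDrop (U : Set ℝ) (h : ℝ → ℕ) (i : ℕ) (d : ℝ) : Prop :=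
  (∃ y ∈ U, y < d) ∧ (∀ y ∈ U, y < d → i < h y) ∧ ∀ y, d < y → h y ≤ i

/-- Two distinct drops would contradict each other at their midpoint, which lies in U because U has
a point below the smaller one. -/
theorem IsDrop.unique {U : Set ℝ} (hU : IsUpperSet U) {h : ℝ → ℕ} {i : ℕ} {d d' : ℝ}
    (hd : IsDrop U h i d) (hd' : IsDrop U h i d') : d = d' := by
  have key : ∀ a b, IsDrop U h i a → IsDrop U h i b → ¬ a < b := by
    rintro a b ⟨⟨y, hy, hya⟩, -, ha⟩ ⟨-, hb, -⟩ hab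
    have h1 := hb ((a + b) / 2) (hU (by linarith : y ≤ (a + b) / 2) hy) (by linarith)
    have h2 := ha ((a + b) / 2) (by linarith)
    omega
  exact le_antisymm (not_lt.1 (key _ _ hd' hd)) (not_lt.1 (key _ _ hd hd'))

theorem setOf_isDrop_eq_Ico {U : Set ℝ} (hU : IsUpperSet U) {h : ℝ → ℕ} (hh : AntitoneOn h U)
    {d ε₀ : ℝ} (h₀ : 0 < ε₀) (hd : d - ε₀ ∈ U) {N : ℕ}
    (hN : ∀ ε, 0 < ε → ε ≤ ε₀ → (h (d - ε) : ℤ) - h (d + ε) = N) :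
    {i | IsDrop U h i d} = Set.Ico (h (d + ε₀)) (h (d - ε₀)) := by
  have mem : ∀ y, d - ε₀ ≤ y → y ∈ U := fun y hy => hU hy hd
  -- A constant difference of two terms that move in opposite directions forces both to be constant.
  have hc : ∀ ε, 0 < ε → ε ≤ ε₀ → h (d - ε) = h (d - ε₀) ∧ h (d + ε) = h (d + ε₀) := by
    intro ε hε hle
    have h1 := hN ε hε hle
    have h2 := hN ε₀ h₀ le_rfl
    have h3 := hh hd (mem (d - ε) (by linarith)) (by linarith : d - ε₀ ≤ d - ε)
    have h4 := hh (mem (d + ε) (by linarith)) (mem (d + ε₀) (by linarith))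
      (by linarith : d + ε ≤ d + ε₀)
    omega
  ext i
  constructor
  · rintro ⟨-, h1, h2⟩
    exact ⟨h2 _ (by linarith), h1 _ hd (by linarith)⟩
  · rintro ⟨h1, h2⟩
    refine ⟨⟨_, hd, by linarith⟩, fun y hy hyd => ?_, fun y hyd => ?_⟩
    · rcases le_or_gt y (d - ε₀) with hle | hlt
      · exact h2.trans_le (hh hy hd hle)
      · have := (hc (d - y) (by linarith) (by linarith)).1
        rw [sub_sub_cancel] at this
        omega
    · rcases le_or_gt (d + ε₀) y with hle | hlt
      · exact (hh (mem _ (by linarith)) (mem _ (by linarith)) hle).trans h1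
      · have := (hc (y - d) (by linarith) (by linarith)).2
        rw [add_sub_cancel] at this
        omega

theorem nonempty_fin_equiv_isDrop {U : Set ℝ} (hU : IsUpperSet U) {h : ℝ → ℕ}
    (hh : AntitoneOn h U) {d ε₀ : ℝ} (h₀ : 0 < ε₀) (hd : d - ε₀ ∈ U) {N : ℕ}
    (hN : ∀ ε, 0 < ε → ε ≤ ε₀ → (h (d - ε) : ℤ) - h (d + ε) = N) :
    Nonempty (Fin N ≃ {i // IsDrop U h i d}) := by
  have hs := setOf_isDrop_eq_Ico hU hh h₀ hd hN
  have hfin : {i | IsDrop U h i d}.Finite := hs ▸ Set.finite_Ico _ _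
  have : Finite {i // IsDrop U h i d} := hfin
  refine ⟨(Finite.equivFinOfCardEq ?_).symm⟩
  have h1 : Nat.card {i // IsDrop U h i d} = {i | IsDrop U h i d}.ncard :=
    Nat.card_coe_set_eq _
  have h2 := hN ε₀ h₀ le_rfl
  rw [h1, hs, ← Finset.coe_Ico, Set.ncard_coe_finset, Nat.card_Ico]
  omega

/-- The new drop is the supremum of the y in V with `i < k y`: `h₁` keeps `k` above i before d - δ,
and `h₂` brings it down to at most i after d + δ. Without `hV` the drop could fall outside V; this
is how points near the diagonal get lost. -/
theorem IsDrop.transfer {U V : Set ℝ} {h k : ℝ → ℕ} {i : ℕ} {d δ : ℝ} (hd : IsDrop U h i d)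
    (hV : ∃ y ∈ V, y < d - δ) (hU : IsUpperSet U)
    (hVup : IsUpperSet V) (hk : AntitoneOn k V)
    (h₁ : ∀ y ∈ V, y + δ ∈ U ∧ h (y + δ) ≤ k y)
    (h₂ : ∀ y ∈ V, y - δ ∈ U → k y ≤ h (y - δ)) :
    ∃ d', |d' - d| ≤ δ ∧ IsDrop V k i d' := by
  obtain ⟨⟨u, hu, hud⟩, hlt, hle⟩ := hd
  obtain ⟨v, hv, hvd⟩ := hV
  have hbig : ∀ y ∈ V, y < d - δ → i < k y := fun y hy hyd =>
    (hlt _ (h₁ y hy).1 (by linarith)).trans_le (h₁ y hy).2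
  set S : Set ℝ := {y | y ∈ V ∧ i < k y} with hS
  have hSb : ∀ y ∈ S, y ≤ d + δ := by
    rintro y ⟨hy, hik⟩
    by_contra! hcon
    have hyU : y - δ ∈ U := hU (by linarith) hu
    have h1 := h₂ y hy hyU
    have h2 := hle (y - δ) (by linarith)
    omega
  have hbdd : BddAbove S := ⟨_, hSb⟩
  have hmid : ∀ y ∈ V, y < d - δ → y ∈ S := fun y hy hyd => ⟨hy, hbig y hy hyd⟩
  have hge : d - δ ≤ sSup S := by
    by_contra! hcon
    -- The maximum with `v` keeps the midpoint inside V.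
    have hw : max v ((sSup S + (d - δ)) / 2) ∈ S :=
      hmid _ (hVup (le_max_left _ _) hv) (max_lt hvd (by linarith))
    have := le_csSup hbdd hw
    have := le_max_right v ((sSup S + (d - δ)) / 2)
    linarith
  refine ⟨sSup S, abs_le.2 ⟨by linarith, ?_⟩, ⟨v, hv, by linarith⟩, fun y hy hys => ?_,
    fun y hys => ?_⟩
  · linarith [csSup_le ⟨v, hmid v hv hvd⟩ hSb]
  · obtain ⟨z, hz, hyz⟩ := exists_lt_of_lt_csSup ⟨v, hmid v hv hvd⟩ hys
    exact hz.2.trans_le (hk hy hz.1 hyz.le)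
  · by_contra! hcon
    exact absurd (le_csSup hbdd ⟨hVup (by linarith : v ≤ y) hv, hcon⟩) (not_le.2 hys)

/-! ### Rank functions -/

/-- The monotonicity properties of size functions, on the half-plane `x + c < y`. -/
structure IsRank (r : ℝ → ℝ → ℤ) (c : ℝ) : Prop where
  mono : ∀ {x₁ x₂ y}, x₁ ≤ x₂ → x₂ + c < y → r x₁ y ≤ r x₂ y
  anti : ∀ {x y₁ y₂}, y₁ ≤ y₂ → x + c < y₁ → r x y₂ ≤ r x y₁
  box : ∀ {x₁ x₂ y₁ y₂}, x₁ ≤ x₂ → y₁ ≤ y₂ → x₂ + c < y₁ →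
    r x₂ y₂ - r x₁ y₂ ≤ r x₂ y₁ - r x₁ y₁

/-- Reflection in the antidiagonal, which exchanges births and deaths. -/
def reflect (r : ℝ → ℝ → ℤ) : ℝ → ℝ → ℤ := fun u v => r (-v) (-u)

theorem IsRank.reflect {r : ℝ → ℝ → ℤ} {c : ℝ} (hr : IsRank r c) : IsRank (reflect r) c where
  mono h h' := hr.anti (neg_le_neg h) (by linarith)
  anti h h' := hr.mono (neg_le_neg h) (by linarith)
  box {x₁ x₂ y₁ y₂} h h' h'' := by
    have := hr.box (neg_le_neg h') (neg_le_neg h) (by linarith : -y₁ + c < -x₂)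
    simp only [SizeTheory.reflect]
    linarith

/-- The alternating sum of `r` over the rectangle of radii `ε` and `η` around `(b, d)`. -/
def boxSum (r : ℝ → ℝ → ℤ) (b d ε η : ℝ) : ℤ :=
  r (b + ε) (d - η) - r (b - ε) (d - η) - r (b + ε) (d + η) + r (b - ε) (d + η)

/-- The multiplicity of the point `(b, d)`. -/
noncomputable def multiplicity (r : ℝ → ℝ → ℤ) (c b d : ℝ) : ℕ :=
  germ (fun ε => b + ε + c < d - ε) (fun ε => boxSum r b d ε ε)

/-- The number of classes born at `b` that are still distinct at `y`. -/
noncomputable def newborn (r : ℝ → ℝ → ℤ) (c b y : ℝ) : ℕ :=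
  germ (fun ε => b + ε + c < y) (fun ε => r (b + ε) y - r (b - ε) y)

theorem multiplicity_reflect (r : ℝ → ℝ → ℤ) (c b d : ℝ) :
    multiplicity (reflect r) c b d = multiplicity r c (-d) (-b) := by
  unfold multiplicity
  congr 1
  · funext ε
    exact propext ⟨fun h => by linarith, fun h => by linarith⟩
  · funext ε
    simp only [boxSum, reflect]
    rw [show -(d - ε) = -d + ε by ring, show -(b + ε) = -b - ε by ring,
      show -(b - ε) = -b + ε by ring, show -(d + ε) = -d - ε by ring]
    ring

section

variable {r : ℝ → ℝ → ℤ} {c : ℝ}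

theorem IsRank.newborn_spec (hr : IsRank r c) {b y : ℝ} (hby : b + c < y) :
    ∃ ε₀, 0 < ε₀ ∧ b + ε₀ + c < y ∧
      ∀ ε, 0 < ε → ε ≤ ε₀ → r (b + ε) y - r (b - ε) y = newborn r c b y := by
  refine germ_spec ⟨(y - b - c) / 2, by linarith, by linarith⟩ ?_ ?_ ?_
  · intro ε ε' _ _ _
    linarith
  · intro ε hε hV
    linarith [hr.mono (by linarith : b - ε ≤ b + ε) hV]
  · intro ε ε' hε hle hV
    have h1 := hr.mono (by linarith : b - ε' ≤ b - ε) (by linarith : b - ε + c < y)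
    have h2 := hr.mono (by linarith : b + ε ≤ b + ε') hV
    linarith

theorem IsRank.newborn_le (hr : IsRank r c) {b y ε : ℝ} (hε : 0 < ε) (hV : b + ε + c < y) :
    (newborn r c b y : ℤ) ≤ r (b + ε) y - r (b - ε) y := by
  have hnn := hr.mono (by linarith : b - ε ≤ b + ε) hV
  have : newborn r c b y ≤ (r (b + ε) y - r (b - ε) y).toNat :=
    Nat.sInf_le ⟨ε, hε, hV, Int.toNat_of_nonneg (by linarith)⟩
  omega

/-- Both germs are read off at one common small radius. -/
theorem newborn_le_newborn {r' : ℝ → ℝ → ℤ} {c' : ℝ} (hr : IsRank r c) (hr' : IsRank r' c')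
    {b y y' : ℝ} (hy : b + c < y) (hy' : b + c' < y')
    (h : ∀ x₁ x₂, x₁ ≤ x₂ → x₂ + c < y → x₂ + c' < y' →
      r x₂ y - r x₁ y ≤ r' x₂ y' - r' x₁ y') :
    newborn r c b y ≤ newborn r' c' b y' := by
  obtain ⟨ε₁, h₁, hV₁, e₁⟩ := hr.newborn_spec hy
  obtain ⟨ε₂, h₂, hV₂, e₂⟩ := hr'.newborn_spec hy'
  have hm := lt_min h₁ h₂
  have hm1 := min_le_left ε₁ ε₂
  have hm2 := min_le_right ε₁ ε₂
  have := h (b - min ε₁ ε₂) (b + min ε₁ ε₂) (by linarith) (by linarith) (by linarith)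
  rw [e₁ _ hm hm1, e₂ _ hm hm2] at this
  exact_mod_cast this

theorem IsRank.antitoneOn_newborn (hr : IsRank r c) (b : ℝ) :
    AntitoneOn (newborn r c b) (Set.Ioi (b + c)) := fun _ hy _ hy' hyy' =>
  newborn_le_newborn hr hr hy' hy fun _ _ hx _ h => hr.box hx hyy' h

/-- The larger rectangle is the smaller one plus four rectangles, each with nonnegative alternating
sum. -/
theorem IsRank.boxSum_mono (hr : IsRank r c) {b d ε ε' η η' : ℝ} (hε : 0 < ε) (hεε' : ε ≤ ε')
    (hη : 0 < η) (hηη' : η ≤ η') (hV : b + ε' + c < d - η') :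
    boxSum r b d ε η ≤ boxSum r b d ε' η' := by
  have h1 := hr.box (x₁ := b + ε) (x₂ := b + ε') (y₁ := d - η) (y₂ := d + η)
    (by linarith) (by linarith) (by linarith)
  have h2 := hr.box (x₁ := b - ε') (x₂ := b - ε) (y₁ := d - η) (y₂ := d + η)
    (by linarith) (by linarith) (by linarith)
  have h3 := hr.box (x₁ := b - ε') (x₂ := b + ε') (y₁ := d - η') (y₂ := d - η)
    (by linarith) (by linarith) (by linarith)
  have h4 := hr.box (x₁ := b - ε') (x₂ := b + ε') (y₁ := d + η) (y₂ := d + η')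
    (by linarith) (by linarith) (by linarith)
  simp only [boxSum]
  linarith

theorem IsRank.boxSum_nonneg (hr : IsRank r c) {b d ε η : ℝ} (hε : 0 < ε) (hη : 0 < η)
    (hV : b + ε + c < d - η) : 0 ≤ boxSum r b d ε η := by
  have := hr.box (x₁ := b - ε) (x₂ := b + ε) (y₁ := d - η) (y₂ := d + η)
    (by linarith) (by linarith) (by linarith)
  simp only [boxSum]
  linarith

theorem IsRank.multiplicity_spec (hr : IsRank r c) {b d : ℝ} (hbd : b + c < d) :
    ∃ ε₀, 0 < ε₀ ∧ b + ε₀ + c < d - ε₀ ∧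
      ∀ ε, 0 < ε → ε ≤ ε₀ → boxSum r b d ε ε = multiplicity r c b d := by
  refine germ_spec ⟨(d - b - c) / 3, by linarith, by linarith⟩ ?_ ?_ ?_
  · intro ε ε' _ _ _
    linarith
  · exact fun ε hε hV => hr.boxSum_nonneg hε hε hV
  · exact fun ε ε' hε hle hV => hr.boxSum_mono hε hle hε hle hV

theorem IsRank.exists_boxSum_eq_newborn_sub (hr : IsRank r c) {b d η : ℝ} (hη : 0 < η)
    (hV : b + c < d - η) {ε' : ℝ} (hε' : 0 < ε') : ∃ ε, 0 < ε ∧ ε ≤ ε' ∧ b + ε + c < d - η ∧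
      boxSum r b d ε η = newborn r c b (d - η) - newborn r c b (d + η) := by
  obtain ⟨ε₁, h₁, hV₁, e₁⟩ := hr.newborn_spec hV
  obtain ⟨ε₂, h₂, hV₂, e₂⟩ := hr.newborn_spec (by linarith : b + c < d + η)
  set m := min ε' (min ε₁ ε₂) with hm
  have hm0 : 0 < m := lt_min hε' (lt_min h₁ h₂)
  have hm1 : m ≤ ε₁ := (min_le_right _ _).trans (min_le_left _ _)
  have hm2 : m ≤ ε₂ := (min_le_right _ _).trans (min_le_right _ _)
  refine ⟨m, hm0, min_le_left _ _, by linarith, ?_⟩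
  rw [← e₁ m hm0 hm1, ← e₂ m hm0 hm2, boxSum]
  ring

/-- The multiplicity of `(b, d)` is the number of drops at `d` of the number of newborns at `b`. -/
theorem IsRank.eventually_newborn_sub_eq (hr : IsRank r c) {b d : ℝ} (hbd : b + c < d) :
    ∃ ε₀, 0 < ε₀ ∧ b + c < d - ε₀ ∧ ∀ ε, 0 < ε → ε ≤ ε₀ →
      (newborn r c b (d - ε) : ℤ) - newborn r c b (d + ε) = multiplicity r c b d := by
  obtain ⟨ε₀, h₀, hV₀, e₀⟩ := hr.multiplicity_spec hbd
  refine ⟨ε₀, h₀, by linarith, fun ε hε hle => ?_⟩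
  -- The rectangle of half-width ζ and half-height ε lies between the squares of radii ζ and ε, on
  -- both of which the sum already equals the multiplicity.
  obtain ⟨ζ, hζ, hζε, hζV, e⟩ := hr.exists_boxSum_eq_newborn_sub (b := b) (d := d) hε (by linarith) hε
  rw [← e]
  apply le_antisymm
  · rw [← e₀ ε hε hle]
    exact hr.boxSum_mono hζ hζε hε le_rfl (by linarith)
  · rw [← e₀ ζ hζ (hζε.trans hle)]
    exact hr.boxSum_mono hζ le_rfl hζ hζε (by linarith)

theorem IsRank.nonempty_fin_multiplicity_equiv (hr : IsRank r c) (b d : ℝ) :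
    Nonempty (Fin (multiplicity r c b d) ≃
      {i // IsDrop (Set.Ioi (b + c)) (newborn r c b) i d}) := by
  by_cases hbd : b + c < d
  · obtain ⟨ε₀, h₀, hV, e⟩ := hr.eventually_newborn_sub_eq hbd
    exact nonempty_fin_equiv_isDrop (isUpperSet_Ioi _) (hr.antitoneOn_newborn b) h₀ hV e
  · have h0 : multiplicity r c b d = 0 := by
      refine (congrArg sInf (Set.eq_empty_of_forall_notMem ?_)).trans Nat.sInf_empty
      rintro n ⟨ε, hε, hV, -⟩
      exact hbd (by linarith)
    rw [h0]
    have : IsEmpty {i // IsDrop (Set.Ioi (b + c)) (newborn r c b) i d} :=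
      ⟨fun ⟨_, ⟨y, hy, hyd⟩, _⟩ => hbd (lt_trans hy hyd)⟩
    exact ⟨Equiv.equivOfIsEmpty _ _⟩

/-- The points of the diagram of `r`, repeated according to their multiplicities. -/
abbrev Diagram (r : ℝ → ℝ → ℤ) (c : ℝ) : Type :=
  Σ p : ℝ × ℝ, Fin (multiplicity r c p.1 p.2)

/-- The `i`-th class born at `p.1` dies at `p.2`. -/
abbrev Drops (r : ℝ → ℝ → ℤ) (c : ℝ) : Type :=
  {t : (ℝ × ℝ) × ℕ // IsDrop (Set.Ioi (t.1.1 + c)) (newborn r c t.1.1) t.2 t.1.2}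

/-- The points of the diagram are the drops of the functions `newborn r c b`. -/
noncomputable def IsRank.diagramEquiv (hr : IsRank r c) : Diagram r c ≃ Drops r c :=
  (Equiv.sigmaCongrRight fun p : ℝ × ℝ => (hr.nonempty_fin_multiplicity_equiv p.1 p.2).some).trans
    (Equiv.subtypeProdEquivSigmaSubtype fun (p : ℝ × ℝ) i =>
      IsDrop (Set.Ioi (p.1 + c)) (newborn r c p.1) i p.2).symm

theorem Drops.ext {t t' : Drops r c} (hb : t.1.1.1 = t'.1.1.1) (hi : t.1.2 = t'.1.2) :
    t = t' := by
  obtain ⟨⟨⟨b, d⟩, i⟩, h⟩ := t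
  obtain ⟨⟨⟨b', d'⟩, i'⟩, h'⟩ := t'
  obtain rfl : b = b' := hb
  obtain rfl : i = i' := hi
  obtain rfl : d = d' := h.unique (isUpperSet_Ioi _) h'
  rfl

/-- If the newborns of two rank functions are `δ`-interleaved in the death coordinate, then the
diagram of the second embeds into the diagram of the first by a motion of the deaths by at most
`δ`, and only points of persistence at most `2δ` are missed. -/
theorem exists_injective_diagram {r s : ℝ → ℝ → ℤ} {δ : ℝ} (hδ : 0 ≤ δ) (hr : IsRank r 0)
    (hs : IsRank s δ)
    (h₁ : ∀ x₁ x₂ y, x₁ ≤ x₂ → x₂ + δ < y →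
      s x₂ y - s x₁ y ≤ r x₂ (y - δ) - r x₁ (y - δ))
    (h₂ : ∀ x₁ x₂ y, x₁ ≤ x₂ → x₂ + δ < y →
      r x₂ (y + δ) - r x₁ (y + δ) ≤ s x₂ y - s x₁ y) :
    ∃ e : Diagram s δ → Diagram r 0, Function.Injective e ∧
      (∀ q, (e q).1.1 = q.1.1 ∧ |(e q).1.2 - q.1.2| ≤ δ) ∧
      ∀ p, p ∉ Set.range e → p.1.2 - p.1.1 ≤ 2 * δ := by
  have n₁ : ∀ b y, b + δ < y → newborn s δ b y ≤ newborn r 0 b (y - δ) := fun b y hy =>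
    newborn_le_newborn hs hr hy (by linarith) fun x₁ x₂ hx hx' _ => h₁ x₁ x₂ y hx hx'
  have n₂ : ∀ b y, b + δ < y → newborn r 0 b (y + δ) ≤ newborn s δ b y := fun b y hy =>
    newborn_le_newborn hr hs (by linarith) hy fun x₁ x₂ hx _ hx' => h₂ x₁ x₂ y hx hx'
  have fwd : ∀ b d i, IsDrop (Set.Ioi (b + δ)) (newborn s δ b) i d →
      ∃ d', |d' - d| ≤ δ ∧ IsDrop (Set.Ioi (b + 0)) (newborn r 0 b) i d' := by
    intro b d i h
    have hbd : b + δ < d := by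
      obtain ⟨⟨y, hy, hyd⟩, -⟩ := h
      exact lt_trans hy hyd
    -- As b + δ < d, the interval (b, d - δ) is nonempty, so every drop of the second function
    -- transfers.
    refine h.transfer ⟨(b + (d - δ)) / 2, ?_, by linarith⟩ (isUpperSet_Ioi _)
      (isUpperSet_Ioi _) (hr.antitoneOn_newborn b) (fun y hy => ?_) (fun y hy hy' => ?_)
    · change b + 0 < _
      linarith
    · have hy : b + 0 < y := hy
      have := n₁ b (y + δ) (by linarith)
      rw [add_sub_cancel_right] at this
      exact ⟨by change b + δ < y + δ; linarith, this⟩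
    · have := n₂ b (y - δ) hy'
      rwa [sub_add_cancel] at this
  have bwd : ∀ b d i, b + 2 * δ < d → IsDrop (Set.Ioi (b + 0)) (newborn r 0 b) i d →
      ∃ d', |d' - d| ≤ δ ∧ IsDrop (Set.Ioi (b + δ)) (newborn s δ b) i d' := by
    intro b d i hbd h
    -- Here the target domain starts at b + δ and must reach below d - δ: this is the origin of the
    -- bound 2δ.
    refine h.transfer ⟨(b + δ + (d - δ)) / 2, ?_, by linarith⟩ (isUpperSet_Ioi _)
      (isUpperSet_Ioi _) (hs.antitoneOn_newborn b) (fun y hy => ⟨?_, n₂ b y hy⟩)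
      (fun y hy _ => n₁ b y hy)
    · change b + δ < _
      linarith
    · have hy : b + δ < y := hy
      change b + 0 < y + δ
      linarith
  choose! F hF hF' using fwd
  set E : Drops s δ → Drops r 0 := fun t =>
    ⟨((t.1.1.1, F t.1.1.1 t.1.1.2 t.1.2), t.1.2), hF' _ _ _ t.2⟩ with hE
  have hEinj : Function.Injective E := fun t t' h =>
    Drops.ext (congrArg (fun u : Drops r 0 => u.1.1.1) h) (congrArg (fun u : Drops r 0 => u.1.2) h)
  refine ⟨fun q => hr.diagramEquiv.symm (E (hs.diagramEquiv q)),
    hr.diagramEquiv.symm.injective.comp (hEinj.comp hs.diagramEquiv.injective),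
    fun q => ⟨rfl, hF _ _ _ (hs.diagramEquiv q).2⟩, fun p hp => ?_⟩
  by_contra! hcon
  obtain ⟨d', hd', hdrop⟩ := bwd p.1.1 p.1.2 (hr.diagramEquiv p).1.2 (by linarith)
    (hr.diagramEquiv p).2
  refine hp ⟨hs.diagramEquiv.symm ⟨((p.1.1, d'), (hr.diagramEquiv p).1.2), hdrop⟩, ?_⟩
  rw [Equiv.symm_apply_eq, Equiv.apply_symm_apply]
  exact Drops.ext rfl rfl

/-- Reflection identifies the diagrams of `r` and `reflect r`. -/
noncomputable def diagramReflect (r : ℝ → ℝ → ℤ) (c : ℝ) : Diagram r c ≃ Diagram (reflect r) c :=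
  Equiv.sigmaCongr ((Equiv.prodComm ℝ ℝ).trans ((Equiv.neg ℝ).prodCongr (Equiv.neg ℝ)))
    fun p => finCongr <| by
      change _ = multiplicity (reflect r) c (-p.2) (-p.1)
      rw [multiplicity_reflect, neg_neg, neg_neg]

/-- The dual of `exists_injective_diagram`, in which the births move. -/
theorem exists_injective_diagram_birth {r s : ℝ → ℝ → ℤ} {δ : ℝ} (hδ : 0 ≤ δ) (hr : IsRank r 0)
    (hs : IsRank s δ)
    (h₁ : ∀ x y₁ y₂, y₁ ≤ y₂ → x + δ < y₁ →
      s x y₁ - s x y₂ ≤ r (x + δ) y₁ - r (x + δ) y₂)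
    (h₂ : ∀ x y₁ y₂, y₁ ≤ y₂ → x + δ < y₁ →
      r (x - δ) y₁ - r (x - δ) y₂ ≤ s x y₁ - s x y₂) :
    ∃ e : Diagram s δ → Diagram r 0, Function.Injective e ∧
      (∀ q, |(e q).1.1 - q.1.1| ≤ δ ∧ (e q).1.2 = q.1.2) ∧
      ∀ p, p ∉ Set.range e → p.1.2 - p.1.1 ≤ 2 * δ := by
  obtain ⟨e, he, he', hmiss⟩ := exists_injective_diagram hδ hr.reflect hs.reflect
    (fun x₁ x₂ y h h' => by
      have := h₁ (-y) (-x₂) (-x₁) (neg_le_neg h) (by linarith)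
      rwa [show -y + δ = -(y - δ) by ring] at this)
    (fun x₁ x₂ y h h' => by
      have := h₂ (-y) (-x₂) (-x₁) (neg_le_neg h) (by linarith)
      rwa [show -y - δ = -(y + δ) by ring] at this)
  refine ⟨fun q => (diagramReflect r 0).symm (e (diagramReflect s δ q)),
    (diagramReflect r 0).symm.injective.comp (he.comp (diagramReflect s δ).injective),
    fun q => ?_, fun p hp => ?_⟩
  · obtain ⟨p, hp⟩ := (diagramReflect r 0).surjective (e (diagramReflect s δ q))
    have h1 := he' (diagramReflect s δ q)
    rw [← hp] at h1
    have h0 : (diagramReflect r 0).symm (e (diagramReflect s δ q)) = p := by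
      rw [← hp, Equiv.symm_apply_apply]
    beta_reduce
    rw [h0]
    have h2 : -p.1.2 = -q.1.2 := h1.1
    have h3 : |-p.1.1 - -q.1.1| ≤ δ := h1.2
    rw [neg_sub_neg, abs_sub_comm] at h3
    exact ⟨h3, neg_injective h2⟩
  · have h := hmiss (diagramReflect r 0 p) fun ⟨q, hq⟩ => hp
      ⟨(diagramReflect s δ).symm q, by simp [hq]⟩
    change -p.1.1 - -p.1.2 ≤ 2 * δ at h
    linarith

/-- The diagram of a rank function is countable. -/
theorem IsRank.countable_diagram (hr : IsRank r c) : Countable (Diagram r c) := by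
  have hcount : (⋃ q : ℚ, {b ∈ Set.Iio ((q : ℝ) - c) |
      ¬ ContinuousWithinAt (fun x => r x q) (Set.Iio ((q : ℝ) - c)) b}).Countable :=
    Set.countable_iUnion fun q => MonotoneOn.countable_not_continuousWithinAt
      fun x _ x' hx' h => hr.mono h (by linarith [Set.mem_Iio.1 hx'])
  set B := ⋃ q : ℚ, {b ∈ Set.Iio ((q : ℝ) - c) |
      ¬ ContinuousWithinAt (fun x => r x q) (Set.Iio ((q : ℝ) - c)) b} with hB
  have hmem : ∀ t : Drops r c, t.1.1.1 ∈ B := by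
    rintro ⟨⟨⟨b, d⟩, i⟩, ⟨y, hy, hyd⟩, hlt, -⟩
    -- A newborn at b survives to a rational level q, so the monotone integer function `r · q` jumps
    -- at b; each of these countably many functions has countably many jumps.
    obtain ⟨q, hyq, hqd⟩ := exists_rat_btwn hyd
    have hq : b + c < q := lt_trans hy hyq
    have hbq : b ∈ Set.Iio ((q : ℝ) - c) := by
      change b < q - c
      linarith
    refine Set.mem_iUnion.2 ⟨q, hbq, fun hcont => ?_⟩
    have hev := (hcont.continuousAt (Iio_mem_nhds hbq)).eventually
      (show ∀ᶠ z in nhds (r b q), z = r b q from by simp)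
    obtain ⟨η, hη, hball⟩ := Metric.eventually_nhds_iff.1 hev
    have hε : 0 < min (η / 2) (((q : ℝ) - b - c) / 2) := lt_min (by linarith) (by linarith)
    set ε := min (η / 2) (((q : ℝ) - b - c) / 2) with hεdef
    have hε1 : ε ≤ η / 2 := min_le_left _ _
    have hε2 : ε ≤ ((q : ℝ) - b - c) / 2 := min_le_right _ _
    have e1 : r (b + ε) q = r b q := hball (by
      rw [Real.dist_eq, add_sub_cancel_left, abs_of_pos hε]; linarith)
    have e2 : r (b - ε) q = r b q := hball (by
      rw [Real.dist_eq, sub_sub_cancel_left, abs_neg, abs_of_pos hε]; linarith)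
    have h1 := hr.newborn_le hε (by linarith : b + ε + c < q)
    have h2 : i < newborn r c b q := hlt q hq hqd
    omega
  have : Countable B := hcount.to_subtype
  have hinj : Function.Injective fun t : Drops r c => ((⟨t.1.1.1, hmem t⟩, t.1.2) : B × ℕ) :=
    fun t t' h => Drops.ext (congrArg (fun u : B × ℕ => (u.1 : ℝ)) h)
      (congrArg (fun u : B × ℕ => u.2) h)
  have := hinj.countable
  exact hr.diagramEquiv.injective.countable

end

/-! ### Size functions as rank functions -/

theorem abs_self_sub_le_zero {M : Type*} (f : M → ℝ) (P : M) : |f P - f P| ≤ 0 := by simp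

section

variable {M : Type*} [TopologicalSpace M]

/-- The number of components of `M⟨g ≤ y⟩` that meet `M⟨f ≤ x⟩`. -/
noncomputable def mixedCount (f g : M → ℝ) (x y : ℝ) : ℤ :=
  componentCount (lowerSet f x) (lowerSet g y)

theorem componentCount_mono {A B K : Set M} (hAB : A ⊆ B)
    (hfin : (connectedComponentIn K '' B).Finite) : componentCount A K ≤ componentCount B K :=
  Set.ncard_le_ncard (Set.image_mono hAB) hfin

variable [CompactSpace M] [LocallyConnectedSpace M]

theorem isRank_mixedCount {f g : M → ℝ} (hg : Continuous g) {c : ℝ}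
    (hfg : ∀ P, |f P - g P| ≤ c) : IsRank (mixedCount f g) c where
  mono h h' := Int.ofNat_le.2 (componentCount_mono (lowerSet_mono h) (finite_components hg hfg h'))
  anti h h' := by
    -- With A empty, the counting inequality becomes monotonicity in the level y.
    have := componentCount_add_le (Set.empty_subset _) (lowerSet_subset_lowerSet hfg h'.le)
      (lowerSet_mono (f := g) h) (finite_components hg hfg h')
    have h0 : ∀ K : Set M, componentCount ∅ K = 0 := fun K => by simp [componentCount]
    rw [h0, h0] at this
    exact Int.ofNat_le.2 this
  box h h' h'' := by
    have := componentCount_add_le (lowerSet_mono (f := f) h)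
      (lowerSet_subset_lowerSet hfg h''.le) (lowerSet_mono (f := g) h')
      (finite_components hg hfg h'')
    simp only [mixedCount]
    omega

theorem exists_injective_diagram_mixedCount {f g : M → ℝ} (hf : Continuous f)
    (hg : Continuous g) {δ : ℝ} (hδ : 0 ≤ δ) (hfg : ∀ P, |f P - g P| ≤ δ) :
    ∃ e : Diagram (mixedCount f g) δ → Diagram (mixedCount f f) 0, Function.Injective e ∧
      (∀ q, (e q).1.1 = q.1.1 ∧ |(e q).1.2 - q.1.2| ≤ δ) ∧
      ∀ p, p ∉ Set.range e → p.1.2 - p.1.1 ≤ 2 * δ := by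
  have hff := abs_self_sub_le_zero f
  have hgf : ∀ P, |g P - f P| ≤ δ := fun P => abs_sub_comm (f P) (g P) ▸ hfg P
  refine exists_injective_diagram hδ (isRank_mixedCount hf hff) (isRank_mixedCount hg hfg) ?_ ?_
  · intro x₁ x₂ y h h'
    have := componentCount_add_le (K := lowerSet f (y - δ)) (K' := lowerSet g y)
      (lowerSet_mono (f := f) h) (lowerSet_mono (by linarith))
      (lowerSet_subset_lowerSet hfg (by linarith))
      (finite_components hf hff (by linarith))
    simp only [mixedCount]
    omega
  · intro x₁ x₂ y h h'
    have := componentCount_add_le (K := lowerSet g y) (K' := lowerSet f (y + δ))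
      (lowerSet_mono (f := f) h) (lowerSet_subset_lowerSet hfg h'.le)
      (lowerSet_subset_lowerSet hgf le_rfl) (finite_components hg hfg h')
    simp only [mixedCount]
    omega

theorem exists_injective_diagram_mixedCount_birth {f g : M → ℝ} (hg : Continuous g) {δ : ℝ}
    (hδ : 0 ≤ δ) (hfg : ∀ P, |f P - g P| ≤ δ) :
    ∃ e : Diagram (mixedCount f g) δ → Diagram (mixedCount g g) 0, Function.Injective e ∧
      (∀ q, |(e q).1.1 - q.1.1| ≤ δ ∧ (e q).1.2 = q.1.2) ∧
      ∀ p, p ∉ Set.range e → p.1.2 - p.1.1 ≤ 2 * δ := by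
  have hgg := abs_self_sub_le_zero g
  have hgf : ∀ P, |g P - f P| ≤ δ := fun P => abs_sub_comm (f P) (g P) ▸ hfg P
  refine exists_injective_diagram_birth hδ (isRank_mixedCount hg hgg) (isRank_mixedCount hg hfg)
    ?_ ?_
  · intro x y₁ y₂ h h'
    have := componentCount_add_le (A := lowerSet f x) (B := lowerSet g (x + δ))
      (lowerSet_subset_lowerSet hfg le_rfl) (lowerSet_mono h'.le) (lowerSet_mono h)
      (finite_components hg hgg (by linarith))
    simp only [mixedCount]
    omega
  · intro x y₁ y₂ h h'
    have := componentCount_add_le (A := lowerSet g (x - δ)) (B := lowerSet f x)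
      (lowerSet_subset_lowerSet hgf (by linarith)) (lowerSet_subset_lowerSet hfg h'.le)
      (lowerSet_mono h) (finite_components hg hfg h')
    simp only [mixedCount]
    omega

omit [CompactSpace M] [LocallyConnectedSpace M] in
theorem coe_sizeFunction (f : M → ℝ) {x y : ℝ} (hxy : x ≤ y) :
    (sizeFunction f x y : ℤ) = mixedCount f f x y :=
  congrArg Nat.cast (sizeFunction_eq_componentCount f hxy)

omit [CompactSpace M] [LocallyConnectedSpace M] in
theorem cornerMultiplicity_finite (f : M → ℝ) (x y : ℝ) :
    cornerMultiplicity (sizeFunction f) (ExtPoint.finite x y) =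
      multiplicity (mixedCount f f) 0 x y := by
  refine congrArg sInf (Set.ext fun n => exists_congr fun ε => and_congr_right fun hε => ?_)
  beta_reduce
  rw [add_zero]
  refine and_congr_right fun hV => ?_
  rw [coe_sizeFunction f hV.le, coe_sizeFunction f (by linarith), coe_sizeFunction f (by linarith),
    coe_sizeFunction f (by linarith)]
  rfl

/-! ### Points at infinity -/

/-- The number of components of `M` that meet `M⟨f ≤ -y⟩`. -/
noncomputable def globalCount (f : M → ℝ) (y : ℝ) : ℕ :=
  componentCount (lowerSet f (-y)) Set.univ

theorem finite_components_univ (A : Set M) :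
    (connectedComponentIn Set.univ '' A).Finite := by
  have h := finite_components (M := M) (f := fun _ => 0) (g := fun _ => 0) continuous_const
    (c := 0) (x := 0) (y := 1) (by simp) (by norm_num)
  have h0 : lowerSet (fun _ : M => (0 : ℝ)) 0 = Set.univ := Set.eq_univ_of_forall fun _ => le_refl (0 : ℝ)
  have h1 : lowerSet (fun _ : M => (0 : ℝ)) 1 = Set.univ :=
    Set.eq_univ_of_forall fun _ => zero_le_one (α := ℝ)
  rw [h0, h1] at h
  exact h.subset (Set.image_mono (Set.subset_univ _))

theorem antitone_globalCount (f : M → ℝ) : Antitone (globalCount f) := fun _ _ h =>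
  componentCount_mono (lowerSet_mono (neg_le_neg h)) (finite_components_univ _)

theorem globalCount_add_le {f g : M → ℝ} {δ : ℝ} (hfg : ∀ P, |f P - g P| ≤ δ) (y : ℝ) :
    globalCount f (y + δ) ≤ globalCount g y :=
  componentCount_mono (lowerSet_subset_lowerSet hfg (by linarith)) (finite_components_univ _)

/-- Once 1/ε bounds f, the level set at 1/ε is all of M, and the multiplicity at infinity is a jump
of `globalCount`. -/
theorem exists_cornerMultiplicity_infinite_eq {f : M → ℝ} (hf : Continuous f) (b : ℝ) :
    ∃ ε₀, 0 < ε₀ ∧ ∀ ε, 0 < ε → ε ≤ ε₀ →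
      (globalCount f (-b - ε) : ℤ) - globalCount f (-b + ε) =
        cornerMultiplicity (sizeFunction f) (ExtPoint.infinite b) := by
  have hr := isRank_mixedCount hf (abs_self_sub_le_zero f)
  have hdiv : ∀ ε ε' : ℝ, 0 < ε → ε ≤ ε' → 1 / ε' ≤ 1 / ε := fun _ _ h h' =>
    one_div_le_one_div_of_le h h'
  obtain ⟨ε₁, h₁, -, e₁⟩ := germ_spec (V := fun ε => b + ε < 1 / ε)
    (h := fun ε => (sizeFunction f (b + ε) (1 / ε) : ℤ) - sizeFunction f (b - ε) (1 / ε))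
    (by
      have hb : (0 : ℝ) < |b| + 2 := by positivity
      refine ⟨1 / (|b| + 2), by positivity, ?_⟩
      rw [one_div_one_div]
      have : 1 / (|b| + 2) ≤ 1 := by
        rw [div_le_one hb]
        linarith [abs_nonneg b]
      linarith [le_abs_self b])
    (fun ε ε' hε hle hV => by linarith [hdiv ε ε' hε hle])
    (fun ε hε hV => by
      rw [coe_sizeFunction f hV.le, coe_sizeFunction f (by linarith)]
      linarith [hr.mono (x₁ := b - ε) (x₂ := b + ε) (y := 1 / ε) (by linarith) (by linarith)])
    (fun ε ε' hε hle hV => by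
      have hd := hdiv ε ε' hε hle
      rw [coe_sizeFunction f hV.le, coe_sizeFunction f (by linarith),
        coe_sizeFunction f (by linarith), coe_sizeFunction f (by linarith)]
      have h1 := hr.box (x₁ := b - ε) (x₂ := b + ε) (y₁ := 1 / ε') (y₂ := 1 / ε)
        (by linarith) hd (by linarith)
      have h2 := hr.mono (x₁ := b + ε) (x₂ := b + ε') (y := 1 / ε') (by linarith) (by linarith)
      have h3 := hr.mono (x₁ := b - ε') (x₂ := b - ε) (y := 1 / ε') (by linarith) (by linarith)
      linarith)
  obtain ⟨C, hC⟩ := (isCompact_range hf).bddAbove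
  -- The term |C| makes 1/ε bound f; the term |b| + 1 gives ε ≤ 1 and keeps b ± ε below 1/ε.
  set D := max |C| (|b| + 1) with hD
  have hD0 : 0 < D := lt_of_lt_of_le (by positivity) (le_max_right _ _)
  have hD1 : |C| ≤ D := le_max_left _ _
  have hD2 : |b| + 1 ≤ D := le_max_right _ _
  refine ⟨min ε₁ (1 / D), lt_min h₁ (by positivity), fun ε hε hle => ?_⟩
  have hεD : ε ≤ 1 / D := hle.trans (min_le_right _ _)
  have hDε : D ≤ 1 / ε := by
    have := hdiv _ _ hε hεD
    rwa [one_div_one_div] at this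
  have hε1 : ε ≤ 1 := hεD.trans (by
    rw [div_le_one hD0]
    linarith [abs_nonneg b])
  have huniv : lowerSet f (1 / ε) = Set.univ := Set.eq_univ_of_forall fun P => by
    have := hC (Set.mem_range_self P)
    change f P ≤ 1 / ε
    linarith [le_abs_self C]
  have hval : ∀ x, x ≤ 1 / ε → (sizeFunction f x (1 / ε) : ℤ) = globalCount f (-x) := by
    intro x hx
    rw [sizeFunction_eq_componentCount f hx, huniv, globalCount, neg_neg]
  have h1 := e₁ ε hε (hle.trans (min_le_left _ _))
  beta_reduce at h1
  rw [hval _ (by linarith [le_abs_self b]), hval _ (by linarith [le_abs_self b])] at h1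
  rw [show -b - ε = -(b + ε) by ring, show -b + ε = -(b - ε) by ring, h1]
  rfl

/-- The points at infinity, repeated according to their multiplicities. -/
abbrev InfiniteDiagram (f : M → ℝ) : Type :=
  Σ b : ℝ, Fin (cornerMultiplicity (sizeFunction f) (ExtPoint.infinite b))

/-- The `i`-th component is born at `t.1`. -/
abbrev InfiniteDrops (f : M → ℝ) : Type :=
  {t : ℝ × ℕ // IsDrop Set.univ (globalCount f) t.2 (-t.1)}

theorem nonempty_fin_infinite_equiv {f : M → ℝ} (hf : Continuous f) (b : ℝ) :
    Nonempty (Fin (cornerMultiplicity (sizeFunction f) (ExtPoint.infinite b)) ≃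
      {i // IsDrop Set.univ (globalCount f) i (-b)}) := by
  obtain ⟨ε₀, h₀, e⟩ := exists_cornerMultiplicity_infinite_eq hf b
  exact nonempty_fin_equiv_isDrop isUpperSet_univ ((antitone_globalCount f).antitoneOn _) h₀
    (Set.mem_univ _) e

/-- The points at infinity are the drops of `globalCount f`. -/
noncomputable def infiniteDiagramEquiv {f : M → ℝ} (hf : Continuous f) :
    InfiniteDiagram f ≃ InfiniteDrops f :=
  (Equiv.sigmaCongrRight fun b => (nonempty_fin_infinite_equiv hf b).some).trans
    (Equiv.subtypeProdEquivSigmaSubtype fun (b : ℝ) i =>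
      IsDrop Set.univ (globalCount f) i (-b)).symm

omit [CompactSpace M] [LocallyConnectedSpace M] in
theorem InfiniteDrops.injective_snd (f : M → ℝ) :
    Function.Injective fun t : InfiniteDrops f => t.1.2 := by
  rintro ⟨⟨b, i⟩, h⟩ ⟨⟨b', i'⟩, h'⟩ hi
  obtain rfl : i = i' := hi
  obtain rfl : b = b' := neg_injective (h.unique isUpperSet_univ h')
  rfl

theorem countable_infiniteDiagram {f : M → ℝ} (hf : Continuous f) :
    Countable (InfiniteDiagram f) :=
  have := (InfiniteDrops.injective_snd f).countable
  (infiniteDiagramEquiv hf).injective.countable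

/-- `globalCount` lives on all of ℝ, so drops always transfer and no point at infinity is lost. -/
theorem exists_infiniteDrop {f g : M → ℝ} {δ : ℝ} (hfg : ∀ P, |f P - g P| ≤ δ) {b : ℝ} {i : ℕ}
    (h : IsDrop Set.univ (globalCount f) i (-b)) :
    ∃ b', |b' - b| ≤ δ ∧ IsDrop Set.univ (globalCount g) i (-b') := by
  have hgf : ∀ P, |g P - f P| ≤ δ := fun P => abs_sub_comm (f P) (g P) ▸ hfg P
  obtain ⟨d, hd, hdrop⟩ := h.transfer (V := Set.univ) (k := globalCount g) (δ := δ)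
    ⟨-b - δ - 1, Set.mem_univ _, by linarith⟩ isUpperSet_univ isUpperSet_univ
    ((antitone_globalCount g).antitoneOn _)
    (fun y _ => ⟨Set.mem_univ _, globalCount_add_le hfg y⟩) (fun y _ _ => by
      have := globalCount_add_le hgf (y - δ)
      rwa [sub_add_cancel] at this)
  refine ⟨-d, ?_, by rwa [neg_neg]⟩
  rwa [← abs_neg, show -(-d - b) = d - -b by ring]

theorem exists_bijective_infiniteDiagram {f g : M → ℝ} (hf : Continuous f) (hg : Continuous g)
    {δ : ℝ} (hfg : ∀ P, |f P - g P| ≤ δ) :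
    ∃ e : InfiniteDiagram f → InfiniteDiagram g, Function.Bijective e ∧
      ∀ q, |(e q).1 - q.1| ≤ δ := by
  have hgf : ∀ P, |g P - f P| ≤ δ := fun P => abs_sub_comm (f P) (g P) ▸ hfg P
  have key := fun t : InfiniteDrops f => exists_infiniteDrop hfg t.2
  choose F hF hF' using key
  set E : InfiniteDrops f → InfiniteDrops g := fun t => ⟨(F t, t.1.2), hF' t⟩ with hE
  have hEbij : Function.Bijective E := by
    constructor
    · exact fun t t' h => InfiniteDrops.injective_snd f
        (congrArg (fun u : InfiniteDrops g => u.1.2) h)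
    · intro t
      obtain ⟨b, -, hb⟩ := exists_infiniteDrop hgf t.2
      exact ⟨⟨(b, t.1.2), hb⟩, InfiniteDrops.injective_snd g rfl⟩
  exact ⟨fun q => (infiniteDiagramEquiv hg).symm (E (infiniteDiagramEquiv hf q)),
    (infiniteDiagramEquiv hg).symm.bijective.comp
      (hEbij.comp (infiniteDiagramEquiv hf).bijective),
    fun q => hF (infiniteDiagramEquiv hf q)⟩

end

/-! ### From partial matchings to the matching distance -/

section

variable {l l₁ l₂ : ℝ → ℝ → ℕ} {A B D R : Type}

theorem IsCornerpoint.not_onDiagonal {p : ExtPoint} (hp : IsCornerpoint l p) :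
    ¬ p.OnDiagonal := by
  rintro ⟨x, rfl⟩
  refine hp.ne' ((congrArg sInf (Set.eq_empty_of_forall_notMem ?_)).trans Nat.sInf_empty)
  rintro n ⟨ε, hε, hV, -⟩
  linarith

theorem isRepresentativeSequence_of_equiv {pt : A → ExtPoint}
    (hpt : ∀ p, Nonempty (Fin (cornerMultiplicity l p) ≃ {a // pt a = p})) [Infinite D]
    (u : ℕ ≃ A ⊕ D) :
    IsRepresentativeSequence l
      fun n => Sum.elim pt (fun _ => ExtPoint.finite 0 0) (u n) where
  cornerpoint_or_diagonal i := by
    rcases hi : u i with a | d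
    · left
      obtain ⟨e⟩ := hpt (pt a)
      exact Fin.pos (e.symm ⟨a, rfl⟩)
    · exact Or.inr ⟨0, rfl⟩
  encard_eq p hp := by
    have hset : {i | Sum.elim pt (fun _ => ExtPoint.finite 0 0) (u i) = p} =
        (fun a => u.symm (Sum.inl a)) '' {a | pt a = p} := by
      ext i
      constructor
      · intro hi
        change Sum.elim pt (fun _ => ExtPoint.finite 0 0) (u i) = p at hi
        rcases hu : u i with a | d
        · rw [hu] at hi
          exact ⟨a, hi, by simp [← hu]⟩
        · rw [hu] at hi
          exact absurd ⟨0, hi.symm⟩ hp.not_onDiagonal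
      · rintro ⟨a, ha, rfl⟩
        change Sum.elim pt (fun _ => ExtPoint.finite 0 0) (u (u.symm (Sum.inl a))) = p
        rw [Equiv.apply_symm_apply]
        exact ha
    obtain ⟨e⟩ := hpt p
    have hinj : Function.Injective fun a => u.symm (Sum.inl a) :=
      u.symm.injective.comp Sum.inl_injective
    rw [hset, hinj.encard_image]
    refine (ENat.card_congr e).symm.trans ?_
    simp
  infinite_diagonal :=
    Set.infinite_of_injective_forall_mem (f := fun d : D => u.symm (Sum.inr d))
      (u.symm.injective.comp Sum.inr_injective) fun d => by
        change (Sum.elim pt (fun _ => ExtPoint.finite 0 0) (u (u.symm (Sum.inr d)))).OnDiagonal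
        rw [Equiv.apply_symm_apply]
        exact ⟨0, rfl⟩

/-- A partial matching, given by injections `e₁` and `e₂` of an index type, bounds the matching
distance if the matched pairs are close and the unmatched points are near the diagonal. -/
theorem matchingDistance_le_of_partialMatching [Countable A] [Countable B]
    {pt₁ : A → ExtPoint} {pt₂ : B → ExtPoint}
    (h₁ : ∀ p, Nonempty (Fin (cornerMultiplicity l₁ p) ≃ {a // pt₁ a = p}))
    (h₂ : ∀ p, Nonempty (Fin (cornerMultiplicity l₂ p) ≃ {b // pt₂ b = p}))
    {e₁ : R → A} {e₂ : R → B} (he₁ : Function.Injective e₁) (he₂ : Function.Injective e₂)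
    {C : ℝ≥0∞} (hR : ∀ t, pointCost (pt₁ (e₁ t)) (pt₂ (e₂ t)) ≤ C)
    (hA : ∀ a, a ∉ Set.range e₁ → pointCost (pt₁ a) (ExtPoint.finite 0 0) ≤ C)
    (hB : ∀ b, b ∉ Set.range e₂ → pointCost (ExtPoint.finite 0 0) (pt₂ b) ≤ C) :
    matchingDistance l₁ l₂ ≤ C := by
  classical
  let A' : Set A := (Set.range e₁)ᶜ
  let B' : Set B := (Set.range e₂)ᶜ
  have : Countable R := he₁.countable
  -- Both sequences are enumerated by the same set: matched pairs, unmatched points of either side,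
  -- spare diagonal points. The first reads B' ⊕ ℕ as diagonal, the second A' ⊕ ℕ, so the identity
  -- permutation realizes the matching.
  obtain ⟨u⟩ : Nonempty (ℕ ≃ R ⊕ A' ⊕ B' ⊕ ℕ) := nonempty_equiv_of_countable
  let α : R ⊕ A' ⊕ B' ⊕ ℕ ≃ A ⊕ B' ⊕ ℕ :=
    (Equiv.sumAssoc R A' (B' ⊕ ℕ)).symm.trans
      (Equiv.sumCongr (((Equiv.ofInjective e₁ he₁).sumCongr (Equiv.refl A')).trans
        (Equiv.Set.sumCompl (Set.range e₁))) (Equiv.refl _))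
  let β : R ⊕ A' ⊕ B' ⊕ ℕ ≃ B ⊕ A' ⊕ ℕ :=
    ((Equiv.refl R).sumCongr ((Equiv.sumAssoc A' B' ℕ).symm.trans
      (((Equiv.sumComm A' B').sumCongr (Equiv.refl ℕ)).trans (Equiv.sumAssoc B' A' ℕ)))).trans
    ((Equiv.sumAssoc R B' (A' ⊕ ℕ)).symm.trans
      (Equiv.sumCongr (((Equiv.ofInjective e₂ he₂).sumCongr (Equiv.refl B')).trans
        (Equiv.Set.sumCompl (Set.range e₂))) (Equiv.refl _)))
  refine (iInf₂_le _ (isRepresentativeSequence_of_equiv h₁ (u.trans α))).trans <|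
    (iInf₂_le _ (isRepresentativeSequence_of_equiv h₂ (u.trans β))).trans <|
      (iInf_le _ 1).trans <| iSup_le fun n => ?_
  change pointCost (Sum.elim pt₁ _ (α (u n))) (Sum.elim pt₂ _ (β (u n))) ≤ C
  rcases u n with t | a | b | n
  · exact hR t
  · exact hA a a.2
  · exact hB b b.2
  · change pointCost (ExtPoint.finite 0 0) (ExtPoint.finite 0 0) ≤ C
    simp [pointCost]

end

/-! ### Stability -/

section

variable {M : Type*} [TopologicalSpace M] [CompactSpace M] [LocallyConnectedSpace M]

/-- The point of the extended plane named by an index. -/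
def indexPoint {f : M → ℝ} : Diagram (mixedCount f f) 0 ⊕ InfiniteDiagram f → ExtPoint :=
  Sum.elim (fun q => ExtPoint.finite q.1.1 q.1.2) (fun q => ExtPoint.infinite q.1)

omit [CompactSpace M] [LocallyConnectedSpace M] in
theorem nonempty_fin_indexPoint_equiv (f : M → ℝ) (p : ExtPoint) :
    Nonempty (Fin (cornerMultiplicity (sizeFunction f) p) ≃
      {a : Diagram (mixedCount f f) 0 ⊕ InfiniteDiagram f // indexPoint a = p}) := by
  rcases p with ⟨x, y⟩ | b
  · rw [cornerMultiplicity_finite]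
    refine ⟨Equiv.ofBijective (fun k => ⟨Sum.inl ⟨(x, y), k⟩, rfl⟩) ⟨fun k k' h => ?_, ?_⟩⟩
    · exact eq_of_heq (Sigma.mk.inj (Sum.inl_injective (congrArg Subtype.val h))).2
    · rintro ⟨⟨⟨x', y'⟩, k⟩ | ⟨b, k⟩, h⟩
      · obtain ⟨rfl, rfl⟩ := ExtPoint.finite.inj h
        exact ⟨k, rfl⟩
      · cases h
  · refine ⟨Equiv.ofBijective (fun k => ⟨Sum.inr ⟨b, k⟩, rfl⟩) ⟨fun k k' h => ?_, ?_⟩⟩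
    · exact eq_of_heq (Sigma.mk.inj (Sum.inr_injective (congrArg Subtype.val h))).2
    · rintro ⟨⟨⟨x', y'⟩, k⟩ | ⟨b, k⟩, h⟩
      · cases h
      · obtain rfl := ExtPoint.infinite.inj h
        exact ⟨k, rfl⟩

/-- Stability of size functions for the matching distance. -/
theorem matchingDistance_sizeFunction_le [Nonempty M] {f g : M → ℝ} (hf : Continuous f)
    (hg : Continuous g) {δ : ℝ} (hfg : ∀ P, |f P - g P| ≤ δ) :
    matchingDistance (sizeFunction f) (sizeFunction g) ≤ ENNReal.ofReal δ := by
  have hδ : 0 ≤ δ := (abs_nonneg _).trans (hfg (Classical.arbitrary M))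
  obtain ⟨e₁, he₁, hd₁, hm₁⟩ := exists_injective_diagram_mixedCount hf hg hδ hfg
  obtain ⟨e₂, he₂, hd₂, hm₂⟩ := exists_injective_diagram_mixedCount_birth hg hδ hfg
  obtain ⟨e, he, hd⟩ := exists_bijective_infiniteDiagram hf hg hfg
  have := (isRank_mixedCount hf (abs_self_sub_le_zero f)).countable_diagram
  have := (isRank_mixedCount hg (abs_self_sub_le_zero g)).countable_diagram
  have := countable_infiniteDiagram hf
  have := countable_infiniteDiagram hg
  refine matchingDistance_le_of_partialMatching (nonempty_fin_indexPoint_equiv f)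
    (nonempty_fin_indexPoint_equiv g) (e₁ := Sum.map e₁ id) (e₂ := Sum.map e₂ e)
    (he₁.sumMap Function.injective_id) (he₂.sumMap he.1) ?_ ?_ ?_
  · rintro (q | q)
    · refine ENNReal.ofReal_le_ofReal ((min_le_left _ _).trans (max_le ?_ ?_))
      · rw [(hd₁ q).1, abs_sub_comm]
        exact (hd₂ q).1
      · rw [(hd₂ q).2]
        exact (hd₁ q).2
    · refine ENNReal.ofReal_le_ofReal ?_
      rw [abs_sub_comm]
      exact hd q
  · rintro (p | p) hp
    -- Against a diagonal point the second term of the cost is half the persistence.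
    · refine ENNReal.ofReal_le_ofReal ((min_le_right _ _).trans (max_le ?_ ?_))
      · linarith [hm₁ p fun ⟨q, hq⟩ => hp ⟨Sum.inl q, congrArg Sum.inl hq⟩]
      · linarith
    · exact absurd ⟨Sum.inr p, rfl⟩ hp
  · rintro (p | p) hp
    · refine ENNReal.ofReal_le_ofReal ((min_le_right _ _).trans (max_le ?_ ?_))
      · linarith
      · linarith [hm₂ p fun ⟨q, hq⟩ => hp ⟨Sum.inl q, congrArg Sum.inl hq⟩]
    · obtain ⟨q, rfl⟩ := he.2 p
      exact absurd ⟨Sum.inr q, rfl⟩ hp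

omit [CompactSpace M] [LocallyConnectedSpace M] in
theorem continuous_reduced {k : ℕ} [Nonempty (Fin k)] (l b : Fin k → ℝ) {φ : M → Fin k → ℝ}
    (hφ : Continuous φ) : Continuous (reduced l b φ) := by
  have : reduced l b φ = fun P =>
      Finset.univ.sup' Finset.univ_nonempty fun i => (φ P i - b i) / l i := by
    funext P
    rw [Finset.sup'_univ_eq_ciSup]
    rfl
  rw [this]
  refine Continuous.finset_sup'_apply _ fun i _ => ?_
  fun_prop

end

theorem reduced_le_add {M : Type*} {k : ℕ} [Nonempty (Fin k)] {l : Fin k → ℝ}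
    (hl : ∀ i, 0 < l i) (b : Fin k → ℝ) (φ χ : M → Fin k → ℝ) {ε : ℝ} {P : M}
    (hε : ‖φ P - χ P‖ ≤ ε) :
    reduced l b φ P ≤ reduced l b χ P + ε / ⨅ i, l i := by
  refine ciSup_le fun i => ?_
  -- The infimum is attained, hence positive.
  obtain ⟨j, hj⟩ := exists_eq_ciInf_of_finite (f := l)
  have hmin : 0 < ⨅ i, l i := hj ▸ hl j
  have h1 : (χ P i - b i) / l i ≤ reduced l b χ P :=
    le_ciSup (f := fun i => (χ P i - b i) / l i) (Set.finite_range _).bddAbove i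
  have h2 : φ P i - χ P i ≤ ε := (le_abs_self _).trans ((norm_le_pi_norm (φ P - χ P) i).trans hε)
  have h3 : (φ P i - χ P i) / l i ≤ ε / ⨅ i, l i :=
    div_le_div₀ ((norm_nonneg _).trans hε) h2 hmin (ciInf_le (Set.finite_range _).bddBelow i)
  have h4 : (φ P i - b i) / l i = (χ P i - b i) / l i + (φ P i - χ P i) / l i := by ring
  linarith

theorem abs_reduced_sub_le {M : Type*} {k : ℕ} [Nonempty (Fin k)] {l : Fin k → ℝ}
    (hl : ∀ i, 0 < l i) (b : Fin k → ℝ) (φ χ : M → Fin k → ℝ) {ε : ℝ} {P : M}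
    (hε : ‖φ P - χ P‖ ≤ ε) :
    |reduced l b φ P - reduced l b χ P| ≤ ε / ⨅ i, l i := by
  have h1 := reduced_le_add hl b φ χ hε
  have h2 := reduced_le_add hl b χ φ (norm_sub_rev (φ P) (χ P) ▸ hε)
  exact abs_sub_le_iff.2 ⟨by linarith, by linarith⟩

theorem Admissible.nonempty {k : ℕ} {l b : Fin k → ℝ} (h : Admissible l b) :
    Nonempty (Fin k) := by
  by_contra hk
  rw [not_nonempty_iff] at hk
  have h0 : WithLp.toLp 2 l = 0 := Subsingleton.elim _ _
  have := h.unit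
  rw [h0, norm_zero] at this
  exact zero_ne_one this

end SizeTheory

theorem mainTheorem3 {M : Type*} [TopologicalSpace M] [Nonempty M] [CompactSpace M]
    [LocallyConnectedSpace M] [T2Space M] {k : ℕ} (φ χ : M → Fin k → ℝ)
    (hφ : Continuous φ) (hχ : Continuous χ) (ε : ℝ) (hε : (⨆ P : M, ‖φ P - χ P‖) ≤ ε)
    (l b : Fin k → ℝ) (hlb : SizeTheory.Admissible l b) :
    SizeTheory.matchingDistance
        (SizeTheory.sizeFunction (SizeTheory.reduced l b φ))
        (SizeTheory.sizeFunction (SizeTheory.reduced l b χ))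
      ≤ ENNReal.ofReal (ε / ⨅ i : Fin k, l i) := by
  have := hlb.nonempty
  -- A real supremum of an unbounded family is 0 by convention; compactness makes `hε` a pointwise
  -- bound.
  have hbdd : BddAbove (Set.range fun P => ‖φ P - χ P‖) :=
    (isCompact_range (hφ.sub hχ).norm).bddAbove
  exact SizeTheory.matchingDistance_sizeFunction_le (SizeTheory.continuous_reduced l b hφ)
    (SizeTheory.continuous_reduced l b hχ) fun P =>
      SizeTheory.abs_reduced_sub_le hlb.pos b φ χ ((le_ciSup hbdd P).trans hε)
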